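/- Let $I\subset\mathbb R$ be a nonempty open set and let $m:I\to(0,\infty)$ be smooth with $m'(u)\neq 0$ for all $u\in I$. Consider the surface of revolution $M$ in $\mathbb R^3$ parametrized by $(u,v)\mapsto (m(u)\cos v,\ m(u)\sin v,\ u)$, $u\in I$, with induced Riemannian norm $$\alpha=\sqrt{(1+m'(u)^2)\,\dot u^2+m(u)^2\,\dot v^2},$$ let $\beta=\dot u$ be the differential of the altitude $z=u$, and let $$F=\frac{\alpha^2}{\alpha-\beta}$$ be the slope metric of $M$. (The condition $m'\ne0$ says exactly that $\beta<\alpha$ for all nonzero tangent vectors, so that $F$ is defined and positive; it includes the case $m'^2>3$, in which $F$ is a strongly convex Finsler metric.) Here a geodesic of a metric function $F$ is a regular curve satisfying the Euler--Lagrange equation of the energy $F^2$. Then: 1. $F$ is not projectively equivalent to $\alpha$, that is, $F$ and $\alpha$ do not have the same geodesics up to orientation-preserving changes of parameter; 2. $F$ is not projectively flat, that is, it is not the case that around every point of $M$ there are smooth local coordinates in which the geodesics of $F$ are, up to orientation-preserving changes of parameter, exactly the straight lines. -/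

import Mathlib

open Real Set Filter Topology
open scoped ContDiff

noncomputable section

/-- The surface of revolution with profile function `m`, parametrized by `(u, v)`:
`(u, v) ↦ (m u * cos v, m u * sin v, u)`. -/
def revolutionSurface (m : ℝ → ℝ) (x : ℝ × ℝ) : EuclideanSpace ℝ (Fin 3) :=
  !₂[m x.1 * cos x.2, m x.1 * sin x.2, x.1]

/-- The Riemannian norm `α` induced by Euclidean 3-space on a parametrized surface `r`:
the length of the velocity in space of the tangent vector with coordinates `y` at `x`. -/
def inducedNorm (r : ℝ × ℝ → EuclideanSpace ℝ (Fin 3)) (x y : ℝ × ℝ) : ℝ :=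
  ‖fderiv ℝ r x y‖

/-- The 1-form `β` of a parametrized surface: the differential of the altitude (the third
coordinate). On a graph `z = f (x, y)` it is `f_x dx + f_y dy`; on a surface of revolution about
the `z`-axis, with `z = u`, it is `du`. -/
def altitudeForm (r : ℝ × ℝ → EuclideanSpace ℝ (Fin 3)) (x y : ℝ × ℝ) : ℝ :=
  (fderiv ℝ r x y) 2

/-- The slope metric `F = α ^ 2 / (α - β)` of a parametrized surface. -/
def slopeMetric (r : ℝ × ℝ → EuclideanSpace ℝ (Fin 3)) (x y : ℝ × ℝ) : ℝ :=
  inducedNorm r x y ^ 2 / (inducedNorm r x y - altitudeForm r x y)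

section Geodesics

variable {E : Type*} [NormedAddCommGroup E] [NormedSpace ℝ E]

/-- `c` is, on the open interval `J`, a geodesic in `U` of the metric function `F`
(`F x y` is the length of the tangent vector `y` at `x`): a regular curve that satisfies the
Euler-Lagrange equation `d/dt (∂(F²)/∂y (c, c')) = ∂(F²)/∂x (c, c')` of the energy. -/
def IsGeodesic (F : E → E → ℝ) (U : Set E) (c : ℝ → E) (J : Set ℝ) : Prop :=
  IsOpen J ∧ J.OrdConnected ∧ ContDiffOn ℝ 2 c J ∧
    ∀ t ∈ J, c t ∈ U ∧ deriv c t ≠ 0 ∧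
      HasDerivAt (fun s => fderiv ℝ (fun y => F (c s) y ^ 2) (deriv c s))
        (fderiv ℝ (fun x => F x (deriv c t) ^ 2) (c t)) t

/-- `σ` is an orientation-preserving change of parameter on the open interval `J`. -/
def IsParameterChange (σ : ℝ → ℝ) (J : Set ℝ) : Prop :=
  IsOpen J ∧ J.OrdConnected ∧ ContDiffOn ℝ 2 σ J ∧ ∀ t ∈ J, 0 < deriv σ t

/-- On the open interval `J`, the curve `c` is a geodesic of `F` in `U` up to an
orientation-preserving change of parameter. -/
def IsUnparamGeodesic (F : E → E → ℝ) (U : Set E) (c : ℝ → E) (J : Set ℝ) : Prop :=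
  ∃ (γ : ℝ → E) (σ : ℝ → ℝ), IsParameterChange σ J ∧ IsGeodesic F U γ (σ '' J) ∧
    ∀ t ∈ J, c t = γ (σ t)

/-- On the open interval `J`, the curve `c` runs along a straight line, up to an
orientation-preserving change of parameter. -/
def IsUnparamLine (c : ℝ → E) (J : Set ℝ) : Prop :=
  ∃ (q w : E) (σ : ℝ → ℝ), w ≠ 0 ∧ IsParameterChange σ J ∧ ∀ t ∈ J, c t = q + σ t • w

/-- `F₁` and `F₂` are projectively equivalent on `U`: they have the same geodesics up to
orientation-preserving changes of parameter. -/
def ProjectivelyEquivalent (F₁ F₂ : E → E → ℝ) (U : Set E) : Prop :=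
  ∀ (c : ℝ → E) (J : Set ℝ), IsUnparamGeodesic F₁ U c J ↔ IsUnparamGeodesic F₂ U c J

/-- `F` is projectively flat on `U`: near every point there are smooth coordinates `Φ` in which
the geodesics of `F` are, up to changes of parameter, exactly the straight lines. -/
def ProjectivelyFlat (F : E → E → ℝ) (U : Set E) : Prop :=
  ∀ p ∈ U, ∃ Φ : OpenPartialHomeomorph E E, p ∈ Φ.source ∧ Φ.source ⊆ U ∧
    ContDiffOn ℝ ∞ Φ Φ.source ∧ ContDiffOn ℝ ∞ Φ.symm Φ.target ∧
    ∀ (c : ℝ → E) (J : Set ℝ), MapsTo c J Φ.source →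
      (IsUnparamGeodesic F U c J ↔ IsUnparamLine (fun t => Φ (c t)) J)

end Geodesics

end

/-!
Write `α² = e(u) u̇² + g(u) v̇²` with `e = 1 + m'²` and `g = m²`, and let `F = α² / (α - u̇)`. Both
assertions fail for the same reason: the geodesics of `F` are not reversible.

Along a geodesic of `F` the value of `F` is constant by conservation of energy
(`IsGeodesic.hasDerivAt_speed`), and `∂(F²)/∂v̇` is constant because `F` does not depend on `v`.
Hence the momentum `P = ∂F/∂v̇ = (α - 2u̇) g v̇ / (α - u̇)²` is constant
(`IsGeodesic.hasDerivAt_rotMomentum`), and, being positively homogeneous of degree `0` in the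
velocity, it is also constant along every reparametrization.

Suppose that `c` and its reverse `t ↦ c (-t)` are both geodesics of `F` up to parameter, and that
`c` starts with velocity `(a, b)`, where `a, b ≠ 0`. Differentiating `P(c, c')` and `P(c, -c')` gives
two linear equations for the derivatives of `s = u̇ / α` and `p = g v̇ / α` whose only solution is
zero (`eq_of_reversible_momentum`). Differentiating the identity `e s² + p² / g = 1` then yields
`e' a² = g' b²` (`eq_of_reversible_geodesic`). If this holds for the directions `(1, 1)` and `(1, 2)`
at one point, then `g' = 2 m m'` vanishes there, contrary to the assumption on `m`.

Both hypotheses to be refuted provide such curves in every direction. The geodesics of `α` exist by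
the Picard-Lindelöf theorem and are reversible since `α` is
(`exists_reversible_geodesic`). In flat coordinates the reverse of a straight line is again a
straight line (`ProjectivelyFlat.exists_reversible_geodesic`).
-/

/-! ### Conservation laws along geodesics and their reparametrizations -/

section Conservation

variable {E : Type*} [NormedAddCommGroup E] [NormedSpace ℝ E]

/-- Euler's identity for functions that are positively homogeneous of degree `2`. -/
theorem fderiv_apply_self_of_homogeneous {f : E → ℝ} {y : E} (hf : DifferentiableAt ℝ f y)
    (hom : ∀ r : ℝ, 0 < r → f (r • y) = r ^ 2 * f y) : fderiv ℝ f y y = 2 * f y := by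
  have hline : HasDerivAt (fun r : ℝ => r • y) y 1 := by
    simpa using (hasDerivAt_id (1 : ℝ)).smul_const y
  have hy : HasFDerivAt f (fderiv ℝ f y) ((1 : ℝ) • y) := by
    rw [one_smul]; exact hf.hasFDerivAt
  have h1 : HasDerivAt (fun r : ℝ => f (r • y)) (fderiv ℝ f y y) 1 :=
    hy.comp_hasDerivAt (1 : ℝ) hline
  have h2 : HasDerivAt (fun r : ℝ => r ^ 2 * f y) (2 * f y) 1 := by
    simpa using (hasDerivAt_pow 2 (1 : ℝ)).mul_const (f y)
  refine h1.unique (h2.congr_of_eventuallyEq ?_)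
  filter_upwards [lt_mem_nhds (zero_lt_one' ℝ)] with r hr using hom r hr

theorem ContDiffOn.hasDerivAt_deriv_of_isOpen {c : ℝ → E} {J : Set ℝ} (hc : ContDiffOn ℝ 2 c J)
    (hJ : IsOpen J) {t : ℝ} (ht : t ∈ J) :
    HasDerivAt c (deriv c t) t ∧ HasDerivAt (deriv c) (deriv (deriv c) t) t := by
  refine ⟨((hc.differentiableOn (by norm_num)).differentiableAt (hJ.mem_nhds ht)).hasDerivAt, ?_⟩
  have h1 : ContDiffOn ℝ 1 (deriv c) J := hc.deriv_of_isOpen hJ (by norm_num)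
  exact ((h1.differentiableOn (by norm_num)).differentiableAt (hJ.mem_nhds ht)).hasDerivAt

/-- Conservation of energy: by Euler's identity `d/dt (∂(F²)/∂y · c') = 2 d/dt F²`, while the
Euler-Lagrange equation turns the left-hand side into `d/dt F²`. -/
theorem IsGeodesic.hasDerivAt_speed {F : E → E → ℝ} {U : Set E} {c : ℝ → E} {J : Set ℝ}
    (h : IsGeodesic F U c J)
    (hF : ∀ x ∈ U, ∀ y, y ≠ 0 → DifferentiableAt ℝ (fun z : E × E => F z.1 z.2) (x, y))
    (hF0 : ∀ x ∈ U, ∀ y, y ≠ 0 → F x y ≠ 0)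
    (hom : ∀ x y, ∀ r : ℝ, 0 < r → F x (r • y) = r * F x y) {t : ℝ} (ht : t ∈ J) :
    HasDerivAt (fun s => F (c s) (deriv c s)) 0 t := by
  obtain ⟨hJ, -, hc, hEL⟩ := h
  obtain ⟨hct, hc0, hel⟩ := hEL t ht
  obtain ⟨hd, hdd⟩ := hc.hasDerivAt_deriv_of_isOpen hJ ht
  have hL : ∀ x ∈ U, ∀ y, y ≠ 0 →
      DifferentiableAt ℝ (fun z : E × E => F z.1 z.2 ^ 2) (x, y) :=
    fun x hx y hy => (hF x hx y hy).pow 2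
  have hLy : ∀ x ∈ U, ∀ y, y ≠ 0 → DifferentiableAt ℝ (fun y => F x y ^ 2) y :=
    fun x hx y hy => (hL x hx y hy).comp y
      (f := fun y : E => (x, y)) (by fun_prop)
  have hpair : HasDerivAt (fun s => (c s, deriv c s)) (deriv c t, deriv (deriv c) t) t :=
    hd.prodMk hdd
  have hFc := (hF _ hct _ hc0).hasFDerivAt.comp_hasDerivAt t hpair
  set T := fderiv ℝ (fun z : E × E => F z.1 z.2 ^ 2) (c t, deriv c t) with hT
  have hTd := (hL _ hct _ hc0).hasFDerivAt
  have hLc : HasDerivAt (fun s => F (c s) (deriv c s) ^ 2)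
      (T (deriv c t, deriv (deriv c) t)) t :=
    HasFDerivAt.comp_hasDerivAt (l := fun z : E × E => F z.1 z.2 ^ 2) t hTd hpair
  have hx : fderiv ℝ (fun x => F x (deriv c t) ^ 2) (c t) (deriv c t) = T (deriv c t, 0) := by
    have := hTd.comp (c t) (hasFDerivAt_prodMk_left (𝕜 := ℝ) (c t) (deriv c t))
    have h2 : fderiv ℝ (fun x => F x (deriv c t) ^ 2) (c t) = _ := this.fderiv
    rw [h2]; simp [hT]
  have hy : fderiv ℝ (fun y => F (c t) y ^ 2) (deriv c t) (deriv (deriv c) t)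
      = T (0, deriv (deriv c) t) := by
    have := hTd.comp (deriv c t) (hasFDerivAt_prodMk_right (𝕜 := ℝ) (c t) (deriv c t))
    have h2 : fderiv ℝ (fun y => F (c t) y ^ 2) (deriv c t) = _ := this.fderiv
    rw [h2]; simp [hT]
  have hlhs := hel.clm_apply hdd
  have heq : (fun s => 2 * F (c s) (deriv c s) ^ 2) =ᶠ[𝓝 t]
      fun s => fderiv ℝ (fun y => F (c s) y ^ 2) (deriv c s) (deriv c s) := by
    filter_upwards [hJ.mem_nhds ht] with s hs
    obtain ⟨hcs, hcs0, -⟩ := hEL s hs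
    refine (fderiv_apply_self_of_homogeneous (hLy _ hcs _ hcs0) fun r hr => ?_).symm
    rw [hom _ _ r hr]; ring
  have huniq := (hlhs.congr_of_eventuallyEq heq).unique (hLc.const_mul 2)
  rw [hx, hy, ← map_add, Prod.mk_add_mk, add_zero, zero_add] at huniq
  -- The derivative of the energy equals twice itself.
  have hT0 : T (deriv c t, deriv (deriv c) t) = 0 := by linarith
  have hsq := (hFc.fun_pow 2).unique hLc
  rw [hT0] at hsq
  have h0 := hF0 _ hct _ hc0
  have hFc0 : fderiv ℝ (fun z : E × E => F z.1 z.2) (c t, deriv c t)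
      (deriv c t, deriv (deriv c) t) = 0 := by simpa [h0] using hsq
  rw [hFc0] at hFc
  exact hFc

theorem IsGeodesic.congr {F₁ F₂ : E → E → ℝ} {U : Set E} (hU : IsOpen U)
    (hF : ∀ x ∈ U, ∀ y, F₁ x y = F₂ x y) {c : ℝ → E} {J : Set ℝ} (h : IsGeodesic F₁ U c J) :
    IsGeodesic F₂ U c J := by
  obtain ⟨hJ, hJ', hc, hEL⟩ := h
  refine ⟨hJ, hJ', hc, fun t ht => ?_⟩
  obtain ⟨hct, hc0, hel⟩ := hEL t ht
  refine ⟨hct, hc0, ?_⟩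
  have h1 : fderiv ℝ (fun x => F₂ x (deriv c t) ^ 2) (c t)
      = fderiv ℝ (fun x => F₁ x (deriv c t) ^ 2) (c t) := by
    apply Filter.EventuallyEq.fderiv_eq
    filter_upwards [hU.mem_nhds hct] with x hx
    rw [hF x hx]
  rw [h1]
  refine hel.congr_of_eventuallyEq ?_
  filter_upwards [hJ.mem_nhds ht] with s hs
  congr 1
  funext y
  rw [hF _ (hEL s hs).1]

theorem IsUnparamGeodesic.congr {F₁ F₂ : E → E → ℝ} {U : Set E} (hU : IsOpen U)
    (hF : ∀ x ∈ U, ∀ y, F₁ x y = F₂ x y) {c : ℝ → E} {J : Set ℝ}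
    (h : IsUnparamGeodesic F₁ U c J) : IsUnparamGeodesic F₂ U c J := by
  obtain ⟨γ, σ, hσ, hγ, hc⟩ := h
  exact ⟨γ, σ, hσ, hγ.congr hU hF, hc⟩

theorem isParameterChange_id {J : Set ℝ} (hJ : IsOpen J) (hJ' : J.OrdConnected) :
    IsParameterChange id J :=
  ⟨hJ, hJ', contDiffOn_id, fun t _ => by simp⟩

theorem IsGeodesic.isUnparamGeodesic {F : E → E → ℝ} {U : Set E} {c : ℝ → E} {J : Set ℝ}
    (h : IsGeodesic F U c J) : IsUnparamGeodesic F U c J :=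
  ⟨c, id, isParameterChange_id h.1 h.2.1, by simpa using h, fun _ _ => rfl⟩

theorem IsUnparamGeodesic.contDiffOn {F : E → E → ℝ} {U : Set E} {c : ℝ → E} {J : Set ℝ}
    (h : IsUnparamGeodesic F U c J) : ContDiffOn ℝ 2 c J := by
  obtain ⟨γ, σ, hσ, hγ, hc⟩ := h
  exact (hγ.2.2.1.comp hσ.2.2.1 (mapsTo_image σ J)).congr hc

/-- A quantity that is positively homogeneous of degree `0` in the velocity and conserved along
geodesics is conserved along their reparametrizations. -/
theorem IsUnparamGeodesic.hasDerivAt_of_homogeneous {F P : E → E → ℝ} {U : Set E} {c : ℝ → E}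
    {J : Set ℝ} (h : IsUnparamGeodesic F U c J)
    (hom : ∀ x y, ∀ r : ℝ, 0 < r → P x (r • y) = P x y)
    (hP : ∀ (γ : ℝ → E) (K : Set ℝ), IsGeodesic F U γ K → ∀ t ∈ K,
      HasDerivAt (fun s => P (γ s) (deriv γ s)) 0 t) {t : ℝ} (ht : t ∈ J) :
    HasDerivAt (fun s => P (c s) (deriv c s)) 0 t := by
  obtain ⟨γ, σ, ⟨hJ, -, hσ, hσ0⟩, hγ, hc⟩ := h
  have h1 := (hP γ _ hγ (σ t) (mem_image_of_mem σ ht)).comp t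
    (hσ.hasDerivAt_deriv_of_isOpen hJ ht).1
  rw [zero_mul] at h1
  refine h1.congr_of_eventuallyEq ?_
  filter_upwards [hJ.mem_nhds ht] with s hs
  have h2 : HasDerivAt c (deriv σ s • deriv γ (σ s)) s := by
    refine ((hγ.2.2.1.hasDerivAt_deriv_of_isOpen hγ.1 (mem_image_of_mem σ hs)).1.scomp s
      (hσ.hasDerivAt_deriv_of_isOpen hJ hs).1).congr_of_eventuallyEq ?_
    filter_upwards [hJ.mem_nhds hs] with r hr using hc r hr
  rw [h2.deriv, hc s hs, hom _ _ _ (hσ0 s hs)]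
  rfl

end Conservation

/-! ### Momentum of the slope metric in rotationally symmetric coordinates -/

/-- The Riemannian norm `√(e(u) u̇² + g(u) v̇²)` of a metric in orthogonal coordinates `(u, v)` whose
coefficients do not depend on `v`. -/
noncomputable def rotNorm (e g : ℝ → ℝ) (x y : ℝ × ℝ) : ℝ :=
  √(e x.1 * y.1 ^ 2 + g x.1 * y.2 ^ 2)

/-- The metric `α² / (α - u̇)` with `α = rotNorm e g`. -/
noncomputable def rotSlope (e g : ℝ → ℝ) (x y : ℝ × ℝ) : ℝ :=
  rotNorm e g x y ^ 2 / (rotNorm e g x y - y.1)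

/-- The momentum `∂F/∂v̇` of `F = rotSlope e g`, conserved along geodesics since `F` does not
depend on `v`. -/
noncomputable def rotMomentum (e g : ℝ → ℝ) (x y : ℝ × ℝ) : ℝ :=
  (rotNorm e g x y - 2 * y.1) * (g x.1 * y.2) / (rotNorm e g x y - y.1) ^ 2

section RotSlope

variable {e g : ℝ → ℝ}

theorem rotNorm_smul (x y : ℝ × ℝ) {r : ℝ} (hr : 0 < r) :
    rotNorm e g x (r • y) = r * rotNorm e g x y := by
  unfold rotNorm
  rw [← Real.sqrt_sq hr.le, ← Real.sqrt_mul (sq_nonneg r), Real.sqrt_sq hr.le]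
  congr 1
  simp only [Prod.smul_fst, Prod.smul_snd, smul_eq_mul]
  ring

theorem rotSlope_smul (x y : ℝ × ℝ) {r : ℝ} (hr : 0 < r) :
    rotSlope e g x (r • y) = r * rotSlope e g x y := by
  unfold rotSlope
  rw [rotNorm_smul x y hr, Prod.smul_fst, smul_eq_mul, ← mul_sub, mul_pow, pow_two r,
    mul_assoc, mul_div_mul_left _ _ hr.ne', mul_div_assoc]

theorem rotMomentum_smul (x y : ℝ × ℝ) {r : ℝ} (hr : 0 < r) :
    rotMomentum e g x (r • y) = rotMomentum e g x y := by
  unfold rotMomentum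
  rw [rotNorm_smul x y hr, Prod.smul_fst, Prod.smul_snd, smul_eq_mul, smul_eq_mul, ← mul_sub,
    mul_pow, ← mul_div_mul_left _ ((rotNorm e g x y - y.1) ^ 2) (pow_ne_zero 2 hr.ne')]
  congr 1
  ring

theorem rotNorm_arg_pos {x y : ℝ × ℝ} (he : 1 < e x.1) (hg : 0 < g x.1) (hy : y ≠ 0) :
    0 < e x.1 * y.1 ^ 2 + g x.1 * y.2 ^ 2 := by
  by_cases h1 : y.1 = 0
  · have h2 : y.2 ≠ 0 := fun h2 => hy (Prod.ext h1 h2)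
    rw [h1]
    have := mul_pos hg (pow_pos (abs_pos.2 h2) 2)
    rw [sq_abs] at this
    linarith
  · have := mul_pos (zero_lt_one.trans he) (pow_pos (abs_pos.2 h1) 2)
    rw [sq_abs] at this
    nlinarith [mul_nonneg hg.le (sq_nonneg y.2)]

theorem rotNorm_pos {x y : ℝ × ℝ} (he : 1 < e x.1) (hg : 0 < g x.1) (hy : y ≠ 0) :
    0 < rotNorm e g x y :=
  Real.sqrt_pos.2 (rotNorm_arg_pos he hg hy)

theorem abs_fst_lt_rotNorm {x y : ℝ × ℝ} (he : 1 < e x.1) (hg : 0 < g x.1) (hy : y ≠ 0) :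
    |y.1| < rotNorm e g x y := by
  refine Real.lt_sqrt_of_sq_lt ?_
  rw [sq_abs]
  by_cases h1 : y.1 = 0
  · have := rotNorm_arg_pos he hg hy
    rw [h1] at this ⊢
    simpa using this
  · nlinarith [mul_nonneg hg.le (sq_nonneg y.2), mul_pos (sub_pos.2 he) (pow_pos (abs_pos.2 h1) 2),
      sq_abs y.1]

theorem rotNorm_sub_pos {x y : ℝ × ℝ} (he : 1 < e x.1) (hg : 0 < g x.1) (hy : y ≠ 0) :
    0 < rotNorm e g x y - y.1 :=
  sub_pos.2 ((le_abs_self _).trans_lt (abs_fst_lt_rotNorm he hg hy))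

theorem rotSlope_pos {x y : ℝ × ℝ} (he : 1 < e x.1) (hg : 0 < g x.1) (hy : y ≠ 0) :
    0 < rotSlope e g x y :=
  div_pos (pow_pos (rotNorm_pos he hg hy) 2) (rotNorm_sub_pos he hg hy)

theorem differentiableAt_rotNorm {x y : ℝ × ℝ} (he : 1 < e x.1) (hg : 0 < g x.1)
    (hed : DifferentiableAt ℝ e x.1) (hgd : DifferentiableAt ℝ g x.1) (hy : y ≠ 0) :
    DifferentiableAt ℝ (fun z : (ℝ × ℝ) × (ℝ × ℝ) => rotNorm e g z.1 z.2) (x, y) := by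
  have h1 : DifferentiableAt ℝ (fun z : (ℝ × ℝ) × (ℝ × ℝ) => e z.1.1) (x, y) :=
    DifferentiableAt.comp (x, y) (g := e) hed (by fun_prop)
  have h2 : DifferentiableAt ℝ (fun z : (ℝ × ℝ) × (ℝ × ℝ) => g z.1.1) (x, y) :=
    DifferentiableAt.comp (x, y) (g := g) hgd (by fun_prop)
  exact DifferentiableAt.sqrt (by fun_prop) (rotNorm_arg_pos he hg hy).ne'

theorem differentiableAt_rotSlope {x y : ℝ × ℝ} (he : 1 < e x.1) (hg : 0 < g x.1)
    (hed : DifferentiableAt ℝ e x.1) (hgd : DifferentiableAt ℝ g x.1) (hy : y ≠ 0) :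
    DifferentiableAt ℝ (fun z : (ℝ × ℝ) × (ℝ × ℝ) => rotSlope e g z.1 z.2) (x, y) := by
  have h1 := differentiableAt_rotNorm he hg hed hgd hy
  have h2 : DifferentiableAt ℝ (fun z : (ℝ × ℝ) × (ℝ × ℝ) => z.2.1) (x, y) := by fun_prop
  have h3 := h1.fun_pow 2
  have h4 := h1.fun_sub h2
  exact h3.fun_mul (h4.inv (rotNorm_sub_pos he hg hy).ne')

/-- `∂(F²)/∂v̇ = 2 F ∂F/∂v̇`, where `∂F/∂v̇` is given by `rotMomentum`. -/
theorem fderiv_rotSlope_sq_apply {x y : ℝ × ℝ} (he : 1 < e x.1) (hg : 0 < g x.1)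
    (hed : DifferentiableAt ℝ e x.1) (hgd : DifferentiableAt ℝ g x.1) (hy : y ≠ 0) :
    fderiv ℝ (fun y => rotSlope e g x y ^ 2) y (0, 1)
      = 2 * rotSlope e g x y * rotMomentum e g x y := by
  have hF : DifferentiableAt ℝ (fun y => rotSlope e g x y ^ 2) y :=
    ((differentiableAt_rotSlope he hg hed hgd hy).pow 2).comp y
      (f := fun y : ℝ × ℝ => (x, y)) (by fun_prop)
  have hline : HasDerivAt (fun r : ℝ => (y.1, r)) (0, 1) y.2 :=
    (hasDerivAt_const _ _).prodMk (hasDerivAt_id _)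
  have h1 : HasDerivAt (fun r : ℝ => rotSlope e g x (y.1, r) ^ 2)
      (fderiv ℝ (fun y => rotSlope e g x y ^ 2) y (0, 1)) y.2 :=
    HasFDerivAt.comp_hasDerivAt (l := fun y => rotSlope e g x y ^ 2) y.2 hF.hasFDerivAt hline
  have hA : HasDerivAt (fun r : ℝ => rotNorm e g x (y.1, r))
      (g x.1 * y.2 / rotNorm e g x y) y.2 := by
    have := (((hasDerivAt_pow 2 y.2).const_mul (g x.1)).const_add (e x.1 * y.1 ^ 2)).sqrt
      (rotNorm_arg_pos he hg hy).ne'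
    refine this.congr_deriv ?_
    unfold rotNorm
    rw [show g x.1 * (((2 : ℕ) : ℝ) * y.2 ^ (2 - 1)) = 2 * (g x.1 * y.2) by push_cast; ring,
      mul_div_mul_left _ _ two_ne_zero]
  have hA0 := (rotNorm_pos he hg hy).ne'
  have hD0 := (rotNorm_sub_pos he hg hy).ne'
  have h2 := (((hA.fun_pow 2).fun_div (hA.sub_const y.1) hD0).fun_pow 2)
  rw [h1.unique h2]
  unfold rotMomentum rotSlope
  simp only [Prod.mk.eta]
  generalize rotNorm e g x y = A at hA0 hD0 ⊢
  generalize y.1 = a at hD0 ⊢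
  simp only [Nat.cast_ofNat, Nat.add_one_sub_one, pow_one]
  field_simp
  ring

variable {U : Set (ℝ × ℝ)}

/-- Conservation of momentum: both `F` and `∂(F²)/∂v̇ = 2 F ∂F/∂v̇` are conserved. -/
theorem IsGeodesic.hasDerivAt_rotMomentum (he : ∀ x ∈ U, 1 < e x.1) (hg : ∀ x ∈ U, 0 < g x.1)
    (hed : ∀ x ∈ U, DifferentiableAt ℝ e x.1) (hgd : ∀ x ∈ U, DifferentiableAt ℝ g x.1)
    {c : ℝ → ℝ × ℝ} {J : Set ℝ} (h : IsGeodesic (rotSlope e g) U c J) {t : ℝ} (ht : t ∈ J) :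
    HasDerivAt (fun s => rotMomentum e g (c s) (deriv c s)) 0 t := by
  have hF := h.hasDerivAt_speed
    (fun x hx y hy => differentiableAt_rotSlope (he x hx) (hg x hx) (hed x hx) (hgd x hx) hy)
    (fun x hx y hy => (rotSlope_pos (he x hx) (hg x hx) hy).ne')
    (fun x y r hr => rotSlope_smul x y hr) ht
  obtain ⟨hJ, -, hc, hEL⟩ := h
  obtain ⟨hct, hc0, hel⟩ := hEL t ht
  -- `F` does not depend on the second coordinate of the point.
  have hx : fderiv ℝ (fun x => rotSlope e g x (deriv c t) ^ 2) (c t) (0, 1) = 0 := by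
    have hd : DifferentiableAt ℝ (fun x => rotSlope e g x (deriv c t) ^ 2) (c t) :=
      ((differentiableAt_rotSlope (he _ hct) (hg _ hct) (hed _ hct) (hgd _ hct) hc0).pow 2).comp
        (c t) (f := fun x : ℝ × ℝ => (x, deriv c t)) (by fun_prop)
    have hline : HasDerivAt (fun r : ℝ => ((c t).1, r)) (0, 1) (c t).2 :=
      (hasDerivAt_const _ _).prodMk (hasDerivAt_id _)
    exact (HasFDerivAt.comp_hasDerivAt (l := fun x => rotSlope e g x (deriv c t) ^ 2) (c t).2
      hd.hasFDerivAt hline).unique (hasDerivAt_const (c t).2 (rotSlope e g (c t) (deriv c t) ^ 2))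
  have h1 : HasDerivAt (fun s => fderiv ℝ (fun y => rotSlope e g (c s) y ^ 2) (deriv c s) (0, 1))
      0 t := by
    have := hel.clm_apply (hasDerivAt_const t ((0, 1) : ℝ × ℝ))
    simpa only [hx, map_zero, add_zero] using this
  have hpos := rotSlope_pos (he _ hct) (hg _ hct) hc0
  have h2 := h1.fun_div (hF.const_mul 2) (by positivity)
  simp only [zero_mul, mul_zero, sub_zero, zero_div] at h2
  refine h2.congr_of_eventuallyEq ?_
  filter_upwards [hJ.mem_nhds ht] with s hs
  obtain ⟨hs1, hs0, -⟩ := hEL s hs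
  have := rotSlope_pos (he _ hs1) (hg _ hs1) hs0
  rw [fderiv_rotSlope_sq_apply (he _ hs1) (hg _ hs1) (hed _ hs1) (hgd _ hs1) hs0]
  field_simp

/-- The algebra behind non-reversibility. Here `A`, `a`, `q` are the values of `α`, `u̇`, `g v̇` and
`A'`, `a'`, `q'` those of their derivatives. The hypotheses say, with denominators cleared and a
factor `A ∓ a` cancelled, that the derivatives of the momentum along `c'` and along `-c'` vanish;
the conclusion says that the derivatives of `u̇ / α` and `g v̇ / α` vanish. -/
theorem eq_of_reversible_momentum {A a q A' a' q' : ℝ} (ha : a ≠ 0) (hq : q ≠ 0)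
    (hA : |a| < A)
    (h1 : ((A' - 2 * a') * q + (A - 2 * a) * q') * (A - a) = 2 * ((A - 2 * a) * q) * (A' - a'))
    (h2 : ((A' + 2 * a') * q + (A + 2 * a) * q') * (A + a) = 2 * ((A + 2 * a) * q) * (A' + a')) :
    a' * A = a * A' ∧ q' * A = q * A' := by
  have hA0 : A ≠ 0 := ((abs_nonneg a).trans_lt hA).ne'
  -- In terms of `X = a' A - a A'` and `Y = q' A - q A'` the hypotheses are the linear system
  -- `(A ∓ a) (A ∓ 2 a) Y = 2 a q X`, obtained after multiplication by `A`.
  have hY : 6 * a * A * (q' * A - q * A') = 0 := by linear_combination A * h2 - A * h1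
  have hY0 : q' * A - q * A' = 0 := by simpa [ha, hA0] using hY
  have hX : 2 * a * q * (a' * A - a * A') = 0 := by
    linear_combination (A - a) * (A - 2 * a) * hY0 - A * h1
  have hX0 : a' * A - a * A' = 0 := by simpa [ha, hq] using hX
  exact ⟨by linarith, by linarith⟩

theorem rotMomentum_neg (x y : ℝ × ℝ) :
    rotMomentum e g x (-y) =
      -((rotNorm e g x y + 2 * y.1) * (g x.1 * y.2) / (rotNorm e g x y + y.1) ^ 2) := by
  have : rotNorm e g x (-y) = rotNorm e g x y := by simp [rotNorm]
  unfold rotMomentum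
  rw [this, Prod.fst_neg, Prod.snd_neg]
  ring

/-- A curve that is a geodesic of `F` in both orientations satisfies `e' u̇² = g' v̇²`: the quotients
`s = u̇ / α` and `p = g v̇ / α` have derivative zero, so that the derivative of the identity
`e s² + p² / g = 1` involves only `e'` and `g'`. -/
theorem eq_of_reversible_geodesic
    (he : ∀ x ∈ U, 1 < e x.1) (hg : ∀ x ∈ U, 0 < g x.1)
    (hed : ∀ x ∈ U, DifferentiableAt ℝ e x.1) (hgd : ∀ x ∈ U, DifferentiableAt ℝ g x.1)
    {c : ℝ → ℝ × ℝ} {J : Set ℝ} (hJ : IsOpen J) (h0 : (0 : ℝ) ∈ J) (hcU : c 0 ∈ U)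
    (h : IsUnparamGeodesic (rotSlope e g) U c J)
    (h' : IsUnparamGeodesic (rotSlope e g) U (fun t => c (-t)) J)
    (ha : (deriv c 0).1 ≠ 0) (hb : (deriv c 0).2 ≠ 0) :
    deriv e (c 0).1 * (deriv c 0).1 ^ 2 = deriv g (c 0).1 * (deriv c 0).2 ^ 2 := by
  have hP := fun (γ : ℝ → ℝ × ℝ) (K : Set ℝ) (hγ : IsGeodesic (rotSlope e g) U γ K) (t : ℝ)
    (ht : t ∈ K) => hγ.hasDerivAt_rotMomentum he hg hed hgd ht
  have hm1 := h.hasDerivAt_of_homogeneous (fun x y r hr => rotMomentum_smul x y hr) hP h0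
  have hm2 := h'.hasDerivAt_of_homogeneous (fun x y r hr => rotMomentum_smul x y hr) hP h0
  -- The second conservation law, read along `c` itself.
  have hm3 : HasDerivAt (fun t => rotMomentum e g (c t) (-deriv c t)) 0 0 := by
    have := hm2.scomp_of_eq (0 : ℝ) (hasDerivAt_neg (0 : ℝ)) neg_zero.symm
    simpa [Function.comp_def, deriv_comp_neg] using this
  obtain ⟨hc, hcc⟩ := h.contDiffOn.hasDerivAt_deriv_of_isOpen hJ h0
  have hu : HasDerivAt (fun t => (c t).1) (deriv c 0).1 0 :=
    HasFDerivAt.comp_hasDerivAt (0 : ℝ) (hasFDerivAt_fst (𝕜 := ℝ) (E := ℝ) (F := ℝ)) hc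
  have hda : HasDerivAt (fun t => (deriv c t).1) (deriv (deriv c) 0).1 0 :=
    HasFDerivAt.comp_hasDerivAt (0 : ℝ) (hasFDerivAt_fst (𝕜 := ℝ) (E := ℝ) (F := ℝ)) hcc
  have hdb : HasDerivAt (fun t => (deriv c t).2) (deriv (deriv c) 0).2 0 :=
    HasFDerivAt.comp_hasDerivAt (0 : ℝ) (hasFDerivAt_snd (𝕜 := ℝ) (E := ℝ) (F := ℝ)) hcc
  have hE : HasDerivAt (fun t => e (c t).1) (deriv e (c 0).1 * (deriv c 0).1) 0 :=
    (hed _ hcU).hasDerivAt.comp (0 : ℝ) hu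
  have hG : HasDerivAt (fun t => g (c t).1) (deriv g (c 0).1 * (deriv c 0).1) 0 :=
    (hgd _ hcU).hasDerivAt.comp (0 : ℝ) hu
  have hy : deriv c 0 ≠ 0 := fun h => ha (by rw [h]; rfl)
  have hpos := rotNorm_arg_pos (he _ hcU) (hg _ hcU) hy
  have hArg := (hE.fun_mul (hda.fun_pow 2)).fun_add (hG.fun_mul (hdb.fun_pow 2))
  obtain ⟨A', hA⟩ : ∃ A', HasDerivAt (fun t => rotNorm e g (c t) (deriv c t)) A' 0 :=
    ⟨_, hArg.sqrt hpos.ne'⟩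
  have hAsq : rotNorm e g (c 0) (deriv c 0) ^ 2 = _ := Real.sq_sqrt hpos.le
  have hA2 := (hA.fun_pow 2).unique (hArg.congr_of_eventuallyEq (by
    filter_upwards [hArg.continuousAt.eventually (lt_mem_nhds hpos)] with t ht
      using Real.sq_sqrt ht.le))
  have hA0 := (rotNorm_pos (he _ hcU) (hg _ hcU) hy).ne'
  have habs := abs_fst_lt_rotNorm (he _ hcU) (hg _ hcU) hy
  have hD1 := (rotNorm_sub_pos (he _ hcU) (hg _ hcU) hy).ne'
  have hD2 : rotNorm e g (c 0) (deriv c 0) + (deriv c 0).1 ≠ 0 := by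
    have := neg_abs_le (deriv c 0).1
    linarith
  have hg0 := (hg _ hcU).ne'
  obtain ⟨q', hq', hq⟩ : ∃ q', q' = _ ∧
      HasDerivAt (fun t => g (c t).1 * (deriv c t).2) q' 0 := ⟨_, rfl, hG.fun_mul hdb⟩
  have d1 := hm1.unique (((hA.fun_sub (hda.const_mul 2)).fun_mul hq).fun_div
    ((hA.fun_sub hda).fun_pow 2) (pow_ne_zero 2 hD1))
  simp only [rotMomentum_neg] at hm3
  have d2 := hm3.unique (((hA.fun_add (hda.const_mul 2)).fun_mul hq).fun_div
    ((hA.fun_add hda).fun_pow 2) (pow_ne_zero 2 hD2)).fun_neg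
  generalize rotNorm e g (c 0) (deriv c 0) = A at *
  generalize (deriv c 0).1 = a at *
  generalize (deriv c 0).2 = b at *
  generalize (deriv (deriv c) 0).1 = a' at *
  simp only [Nat.cast_ofNat, Nat.add_one_sub_one, pow_one] at d1 d2 hA2
  rw [eq_comm, div_eq_zero_iff, or_iff_left (by positivity)] at d1
  rw [eq_comm, neg_eq_zero, div_eq_zero_iff, or_iff_left (by positivity)] at d2
  obtain ⟨hX, hY⟩ := eq_of_reversible_momentum (A' := A') (a' := a') (q' := q') ha
    (mul_ne_zero hg0 hb) habs
    (mul_right_cancel₀ hD1 (by linear_combination d1))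
    (mul_right_cancel₀ hD2 (by linear_combination d2))
  have hfin : (deriv e (c 0).1 * a ^ 2 - deriv g (c 0).1 * b ^ 2) * (a * A) = 0 := by
    rw [hq'] at hY
    linear_combination -A * hA2 - 2 * e (c 0).1 * a * hX - 2 * b * hY + 2 * A' * hAsq
  have := (mul_eq_zero.1 hfin).resolve_right (mul_ne_zero ha hA0)
  linarith

end RotSlope

/-! ### Geodesics of the Riemannian norm -/

theorem ContDiffAt.deriv_of_two {f : ℝ → ℝ} {u : ℝ} (hf : ContDiffAt ℝ 2 f u) :
    ContDiffAt ℝ 1 (deriv f) u :=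
  (hf.fderiv_right (m := 1) (by norm_num)).clm_apply contDiffAt_const

section RotNorm

variable {e g : ℝ → ℝ} {U : Set (ℝ × ℝ)}

/-- The acceleration of the geodesics of `rotNorm e g`, so that `c'' = rotAccel e g c c'`
is their equation. -/
noncomputable def rotAccel (e g : ℝ → ℝ) (x y : ℝ × ℝ) : ℝ × ℝ :=
  ((deriv g x.1 * y.2 ^ 2 - deriv e x.1 * y.1 ^ 2) / (2 * e x.1),
    -(deriv g x.1 * y.1 * y.2) / g x.1)

theorem rotAccel_neg (x y : ℝ × ℝ) : rotAccel e g x (-y) = rotAccel e g x y := by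
  simp [rotAccel]

theorem hasFDerivAt_quadratic (p q : ℝ) (y : ℝ × ℝ) :
    HasFDerivAt (fun y : ℝ × ℝ => p * y.1 ^ 2 + q * y.2 ^ 2)
      ((2 * p * y.1) • ContinuousLinearMap.fst ℝ ℝ ℝ +
        (2 * q * y.2) • ContinuousLinearMap.snd ℝ ℝ ℝ) y := by
  have h1 := ((hasFDerivAt_fst (𝕜 := ℝ) (p := y)).pow 2).const_mul p
  have h2 := ((hasFDerivAt_snd (𝕜 := ℝ) (p := y)).pow 2).const_mul q
  refine (h1.fun_add h2).congr_fderiv ?_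
  ext <;> simp <;> ring

/-- Curves with `c'' = rotAccel e g c c'` satisfy the Euler-Lagrange equation of the Riemannian
energy. The second-order equation is given as a first-order system with velocity `w`. -/
theorem isGeodesic_of_hasDerivAt (hU : IsOpen U)
    (he : ∀ x ∈ U, 1 < e x.1) (hg : ∀ x ∈ U, 0 < g x.1)
    (hed : ∀ x ∈ U, ContDiffAt ℝ 2 e x.1) (hgd : ∀ x ∈ U, ContDiffAt ℝ 2 g x.1)
    {c w : ℝ → ℝ × ℝ} {J : Set ℝ} (hJ : IsOpen J) (hJ' : J.OrdConnected)
    (hcU : ∀ t ∈ J, c t ∈ U) (hw : ∀ t ∈ J, w t ≠ 0)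
    (hc : ∀ t ∈ J, HasDerivAt c (w t) t)
    (hcc : ∀ t ∈ J, HasDerivAt w (rotAccel e g (c t) (w t)) t) :
    IsGeodesic (rotNorm e g) U c J := by
  have hsq : ∀ x ∈ U, ∀ y : ℝ × ℝ,
      rotNorm e g x y ^ 2 = e x.1 * y.1 ^ 2 + g x.1 * y.2 ^ 2 := fun x hx y =>
    Real.sq_sqrt (add_nonneg (mul_nonneg (zero_lt_one.trans (he x hx)).le (sq_nonneg _))
      (mul_nonneg (hg x hx).le (sq_nonneg _)))
  have hdc : ∀ t ∈ J, deriv c t = w t := fun t ht => (hc t ht).deriv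
  have hcont : ContinuousOn c J := fun t ht => (hc t ht).continuousAt.continuousWithinAt
  have hwcont : ContinuousOn w J := fun t ht => (hcc t ht).continuousAt.continuousWithinAt
  have hC2 : ContDiffOn ℝ 2 c J := by
    have hw1 : ContDiffOn ℝ 1 w J := by
      rw [show (1 : WithTop ℕ∞) = 0 + 1 from rfl, contDiffOn_succ_iff_deriv_of_isOpen hJ]
      refine ⟨fun t ht => (hcc t ht).differentiableAt.differentiableWithinAt, by simp, ?_⟩
      rw [contDiffOn_zero]
      refine ContinuousOn.congr (f := fun t => rotAccel e g (c t) (w t)) ?_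
        fun t ht => (hcc t ht).deriv
      have hu : ContinuousOn (fun t => (c t).1) J := hcont.fst
      have hcomp : ∀ f : ℝ → ℝ, (∀ x ∈ U, ContinuousAt f x.1) →
          ContinuousOn (fun t => f (c t).1) J := fun f hf t ht =>
        ContinuousAt.comp_continuousWithinAt (g := f) (hf _ (hcU t ht)) (hu t ht)
      have h1 := hcomp e fun x hx => (hed x hx).continuousAt
      have h2 := hcomp g fun x hx => (hgd x hx).continuousAt
      have h3 := hcomp (deriv e) fun x hx => (hed x hx).deriv_of_two.continuousAt
      have h4 := hcomp (deriv g) fun x hx => (hgd x hx).deriv_of_two.continuousAt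
      have h5 := hwcont.fst
      have h6 := hwcont.snd
      refine ContinuousOn.prodMk (ContinuousOn.div ((h4.mul (h6.pow 2)).sub (h3.mul (h5.pow 2)))
        (continuousOn_const.mul h1) fun t ht => ?_)
        (ContinuousOn.div ((h4.mul h5).mul h6).neg h2 fun t ht => (hg _ (hcU t ht)).ne')
      have := he _ (hcU t ht)
      positivity
    rw [show (2 : WithTop ℕ∞) = 1 + 1 from rfl, contDiffOn_succ_iff_deriv_of_isOpen hJ]
    exact ⟨fun t ht => (hc t ht).differentiableAt.differentiableWithinAt, by simp,
      hw1.congr hdc⟩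
  refine ⟨hJ, hJ', hC2, fun t ht => ⟨hcU t ht, by rw [hdc t ht]; exact hw t ht, ?_⟩⟩
  have hct := hcU t ht
  have hy : ∀ s ∈ J, fderiv ℝ (fun y => rotNorm e g (c s) y ^ 2) (deriv c s) =
      (2 * e (c s).1 * (w s).1) • ContinuousLinearMap.fst ℝ ℝ ℝ +
        (2 * g (c s).1 * (w s).2) • ContinuousLinearMap.snd ℝ ℝ ℝ := fun s hs => by
    simp only [hsq _ (hcU s hs), hdc s hs]
    exact (hasFDerivAt_quadratic _ _ _).fderiv
  have hE := ((hed _ hct).differentiableAt (by norm_num)).hasDerivAt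
  have hG := ((hgd _ hct).differentiableAt (by norm_num)).hasDerivAt
  have hx : fderiv ℝ (fun x => rotNorm e g x (deriv c t) ^ 2) (c t) =
      (deriv e (c t).1 * (w t).1 ^ 2 + deriv g (c t).1 * (w t).2 ^ 2) •
        ContinuousLinearMap.fst ℝ ℝ ℝ := by
    rw [hdc t ht]
    have h1 := (hE.comp_hasFDerivAt (c t)
      (hasFDerivAt_fst (𝕜 := ℝ) (p := c t))).mul_const ((w t).1 ^ 2)
    have h2 := (hG.comp_hasFDerivAt (c t)
      (hasFDerivAt_fst (𝕜 := ℝ) (p := c t))).mul_const ((w t).2 ^ 2)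
    refine HasFDerivAt.fderiv (((h1.fun_add h2).congr_fderiv ?_).congr_of_eventuallyEq ?_)
    · ext <;> simp
      ring
    · filter_upwards [hU.mem_nhds hct] with x hx using hsq x hx _
  have hu : HasDerivAt (fun s => (c s).1) (w t).1 t :=
    HasFDerivAt.comp_hasDerivAt t (hasFDerivAt_fst (𝕜 := ℝ) (E := ℝ) (F := ℝ)) (hc t ht)
  have ha : HasDerivAt (fun s => (w s).1) (rotAccel e g (c t) (w t)).1 t :=
    HasFDerivAt.comp_hasDerivAt t (hasFDerivAt_fst (𝕜 := ℝ) (E := ℝ) (F := ℝ)) (hcc t ht)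
  have hb : HasDerivAt (fun s => (w s).2) (rotAccel e g (c t) (w t)).2 t :=
    HasFDerivAt.comp_hasDerivAt t (hasFDerivAt_snd (𝕜 := ℝ) (E := ℝ) (F := ℝ)) (hcc t ht)
  have hEc : HasDerivAt (fun s => e (c s).1) (deriv e (c t).1 * (w t).1) t := hE.comp t hu
  have hGc : HasDerivAt (fun s => g (c s).1) (deriv g (c t).1 * (w t).1) t := hG.comp t hu
  have hmain := (((hEc.const_mul 2).fun_mul ha).smul_const
    (ContinuousLinearMap.fst ℝ ℝ ℝ)).fun_add
    (((hGc.const_mul 2).fun_mul hb).smul_const (ContinuousLinearMap.snd ℝ ℝ ℝ))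
  rw [hx]
  refine (hmain.congr_of_eventuallyEq ?_).congr_deriv ?_
  · filter_upwards [hJ.mem_nhds ht] with s hs using hy s hs
  · have he0 := (zero_lt_one.trans (he _ hct)).ne'
    have hg0 := (hg _ hct).ne'
    ext <;> simp [rotAccel] <;> field_simp <;> ring

/-- Since `rotNorm e g` is reversible, the geodesics given by the Picard-Lindelöf theorem remain
geodesics when their orientation is reversed. -/
theorem exists_reversible_geodesic (hU : IsOpen U)
    (he : ∀ x ∈ U, 1 < e x.1) (hg : ∀ x ∈ U, 0 < g x.1)
    (hed : ∀ x ∈ U, ContDiffAt ℝ 2 e x.1) (hgd : ∀ x ∈ U, ContDiffAt ℝ 2 g x.1)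
    {p y : ℝ × ℝ} (hp : p ∈ U) (hy : y ≠ 0) :
    ∃ (c : ℝ → ℝ × ℝ) (J : Set ℝ), IsOpen J ∧ (0 : ℝ) ∈ J ∧ c 0 = p ∧ deriv c 0 = y ∧
      IsGeodesic (rotNorm e g) U c J ∧ IsGeodesic (rotNorm e g) U (fun t => c (-t)) J := by
  have hf : ContDiffAt ℝ 1
      (fun z : (ℝ × ℝ) × (ℝ × ℝ) => (z.2, rotAccel e g z.1 z.2)) (p, y) := by
    have hcomp : ∀ f : ℝ → ℝ, ContDiffAt ℝ 1 f p.1 →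
        ContDiffAt ℝ 1 (fun z : (ℝ × ℝ) × (ℝ × ℝ) => f z.1.1) (p, y) := fun f hf =>
      ContDiffAt.comp (g := f) (p, y) hf (by fun_prop)
    have h1 := hcomp e ((hed p hp).of_le (by norm_num))
    have h2 := hcomp g ((hgd p hp).of_le (by norm_num))
    have h3 := hcomp (deriv e) (hed p hp).deriv_of_two
    have h4 := hcomp (deriv g) (hgd p hp).deriv_of_two
    have := he p hp
    have h5 : ContDiffAt ℝ 1 (fun z : (ℝ × ℝ) × (ℝ × ℝ) => z.2.1) (p, y) := by fun_prop
    have h6 : ContDiffAt ℝ 1 (fun z : (ℝ × ℝ) × (ℝ × ℝ) => z.2.2) (p, y) := by fun_prop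
    refine ContDiffAt.prodMk (by fun_prop) (ContDiffAt.prodMk
      (ContDiffAt.div ((h4.mul (h6.pow 2)).sub (h3.mul (h5.pow 2))) (contDiffAt_const.mul h1) ?_)
      (ContDiffAt.div ((h4.mul h5).mul h6).neg h2 (hg p hp).ne'))
    positivity
  obtain ⟨z, hz0, ε, hε, hz⟩ :=
    hf.exists_forall_mem_closedBall_exists_eq_forall_mem_Ioo_hasDerivAt₀ (0 : ℝ)
  have hcont : ContinuousAt z 0 := (hz 0 (by simpa using hε)).continuousAt
  have hnhds : ∀ᶠ t in 𝓝 (0 : ℝ), (z t).1 ∈ U ∧ (z t).2 ≠ 0 := by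
    have h1 : ContinuousAt (fun t => (z t).1) 0 := hcont.fst
    have h2 : ContinuousAt (fun t => (z t).2) 0 := hcont.snd
    refine (h1.eventually (hU.mem_nhds ?_)).and (h2.eventually_ne ?_)
    · simpa only [hz0] using hp
    · simpa only [hz0] using hy
  obtain ⟨δ, hδ, hδ'⟩ := Metric.eventually_nhds_iff.1 hnhds
  set η := min ε δ
  have hη0 : 0 < η := lt_min hε hδ
  have hsol : ∀ t ∈ Ioo (-η) η, ((z t).1 ∈ U ∧ (z t).2 ≠ 0) ∧
      HasDerivAt z ((z t).2, rotAccel e g (z t).1 (z t).2) t := fun t ht => by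
    have ht' : |t| < η := abs_lt.2 ht
    have h1 := abs_lt.1 (ht'.trans_le (min_le_left ε δ))
    refine ⟨hδ' ?_, hz t ⟨by linarith, by linarith⟩⟩
    simpa [Real.dist_eq] using ht'.trans_le (min_le_right ε δ)
  have hd1 : ∀ t ∈ Ioo (-η) η, HasDerivAt (fun t => (z t).1) (z t).2 t := fun t ht =>
    HasFDerivAt.comp_hasDerivAt t (hasFDerivAt_fst (𝕜 := ℝ) (E := ℝ × ℝ) (F := ℝ × ℝ))
      (hsol t ht).2
  have hd2 : ∀ t ∈ Ioo (-η) η,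
      HasDerivAt (fun t => (z t).2) (rotAccel e g (z t).1 (z t).2) t := fun t ht =>
    HasFDerivAt.comp_hasDerivAt t (hasFDerivAt_snd (𝕜 := ℝ) (E := ℝ × ℝ) (F := ℝ × ℝ))
      (hsol t ht).2
  have hneg : ∀ t ∈ Ioo (-η) η, -t ∈ Ioo (-η) η := fun t ht =>
    ⟨neg_lt_neg ht.2, neg_lt.1 ht.1⟩
  have h0 : (0 : ℝ) ∈ Ioo (-η) η := ⟨neg_lt_zero.2 hη0, hη0⟩
  refine ⟨fun t => (z t).1, Ioo (-η) η, isOpen_Ioo, h0, by simp [hz0],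
    by rw [(hd1 0 h0).deriv, hz0],
    isGeodesic_of_hasDerivAt hU he hg hed hgd isOpen_Ioo ordConnected_Ioo
      (fun t ht => (hsol t ht).1.1) (fun t ht => (hsol t ht).1.2) hd1 hd2,
    isGeodesic_of_hasDerivAt (w := fun t => -(z (-t)).2) hU he hg hed hgd isOpen_Ioo
      ordConnected_Ioo (fun t ht => (hsol _ (hneg t ht)).1.1)
      (fun t ht => neg_ne_zero.2 (hsol _ (hneg t ht)).1.2) (fun t ht => ?_) (fun t ht => ?_)⟩
  · simpa [Function.comp_def] using (hd1 _ (hneg t ht)).scomp t (hasDerivAt_neg t)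
  · rw [rotAccel_neg]
    simpa [Function.comp_def] using ((hd2 _ (hneg t ht)).scomp t (hasDerivAt_neg t)).fun_neg

end RotNorm

/-! ### Straight lines in flat coordinates -/

section Flat

variable {E : Type*} [NormedAddCommGroup E] [NormedSpace ℝ E]

/-- In flat coordinates the reverse of a straight line is a straight line, so through every
point and in every direction there is a geodesic whose reverse is a geodesic. -/
theorem ProjectivelyFlat.exists_reversible_geodesic {F : E → E → ℝ} {U : Set E}
    (h : ProjectivelyFlat F U) {p y : E} (hp : p ∈ U) (hy : y ≠ 0) :
    ∃ (c : ℝ → E) (J : Set ℝ), IsOpen J ∧ (0 : ℝ) ∈ J ∧ c 0 = p ∧ deriv c 0 = y ∧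
      IsUnparamGeodesic F U c J ∧ IsUnparamGeodesic F U (fun t => c (-t)) J := by
  obtain ⟨Φ, hpΦ, -, hΦ, hΦ', hgeo⟩ := h p hp
  have hq : Φ p ∈ Φ.target := Φ.map_source hpΦ
  have hd : DifferentiableAt ℝ Φ p :=
    (hΦ.differentiableOn (by simp)).differentiableAt (Φ.open_source.mem_nhds hpΦ)
  have hd' : DifferentiableAt ℝ Φ.symm (Φ p) :=
    (hΦ'.differentiableOn (by simp)).differentiableAt (Φ.open_target.mem_nhds hq)
  have hinv : fderiv ℝ Φ.symm (Φ p) (fderiv ℝ Φ p y) = y := by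
    have h1 := hd'.hasFDerivAt.comp p hd.hasFDerivAt
    have h2 : HasFDerivAt (Φ.symm ∘ Φ) (ContinuousLinearMap.id ℝ E) p := by
      refine (hasFDerivAt_id p).congr_of_eventuallyEq ?_
      filter_upwards [Φ.open_source.mem_nhds hpΦ] with x hx using Φ.left_inv hx
    exact DFunLike.congr_fun (h1.unique h2) y
  set w := fderiv ℝ Φ p y
  have hw0 : w ≠ 0 := fun h0 => hy (by rw [← hinv, h0, map_zero])
  have hline : HasDerivAt (fun t : ℝ => Φ p + t • w) w 0 := by
    simpa using ((hasDerivAt_id (0 : ℝ)).smul_const w).const_add (Φ p)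
  have hc : HasDerivAt (fun t : ℝ => Φ.symm (Φ p + t • w)) y 0 := by
    rw [← hinv]
    refine HasFDerivAt.comp_hasDerivAt (0 : ℝ) ?_ hline
    simpa using hd'.hasFDerivAt
  obtain ⟨ε, hε, hεt⟩ := Metric.eventually_nhds_iff.1
    (hline.continuousAt.eventually (Φ.open_target.mem_nhds (by simpa using hq)))
  have htar : ∀ t ∈ Ioo (-ε) ε, Φ p + t • w ∈ Φ.target := fun t ht =>
    hεt (by simpa [Real.dist_eq] using abs_lt.2 ht)
  have hneg : ∀ t ∈ Ioo (-ε) ε, -t ∈ Ioo (-ε) ε := fun t ht =>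
    ⟨neg_lt_neg ht.2, neg_lt.1 ht.1⟩
  have hid := isParameterChange_id (isOpen_Ioo (a := -ε) (b := ε)) ordConnected_Ioo
  refine ⟨fun t => Φ.symm (Φ p + t • w), Ioo (-ε) ε, isOpen_Ioo, ⟨neg_lt_zero.2 hε, hε⟩,
    by simpa using Φ.left_inv hpΦ, hc.deriv, ?_, ?_⟩
  · exact (hgeo _ _ fun t ht => Φ.map_target (htar t ht)).2
      ⟨Φ p, w, id, hw0, hid, fun t ht => Φ.right_inv (htar t ht)⟩
  · refine (hgeo _ _ fun t ht => Φ.map_target (htar _ (hneg t ht))).2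
      ⟨Φ p, -w, id, neg_ne_zero.2 hw0, hid, fun t ht => ?_⟩
    have := Φ.right_inv (htar _ (hneg t ht))
    simpa using this

end Flat

/-! ### The surface of revolution -/

section Revolution

variable {m : ℝ → ℝ}

theorem fderiv_revolutionSurface {x : ℝ × ℝ} (hm : DifferentiableAt ℝ m x.1) (y : ℝ × ℝ) :
    fderiv ℝ (revolutionSurface m) x y =
      !₂[deriv m x.1 * y.1 * cos x.2 - m x.1 * sin x.2 * y.2,
        deriv m x.1 * y.1 * sin x.2 + m x.1 * cos x.2 * y.2, y.1] := by
  have h1 := hm.hasDerivAt.comp_hasFDerivAt x (hasFDerivAt_fst (𝕜 := ℝ) (p := x))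
  have h2 := (Real.hasDerivAt_cos x.2).comp_hasFDerivAt x (hasFDerivAt_snd (𝕜 := ℝ) (p := x))
  have h3 := (Real.hasDerivAt_sin x.2).comp_hasFDerivAt x (hasFDerivAt_snd (𝕜 := ℝ) (p := x))
  have h12 := h1.mul h2
  have h13 := h1.mul h3
  have hdiff : DifferentiableAt ℝ (revolutionSurface m) x := by
    rw [differentiableAt_euclidean]
    intro i
    fin_cases i
    · exact h12.differentiableAt
    · exact h13.differentiableAt
    · exact differentiableAt_fst
  have hcoord : ∀ i, fderiv ℝ (revolutionSurface m) x y i =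
      fderiv ℝ (fun x => revolutionSurface m x i) x y := fun i => by
    have := hasFDerivWithinAt_euclidean.1
      (hdiff.hasFDerivAt.hasFDerivWithinAt (s := univ)) i
    rw [(hasFDerivWithinAt_univ.1 this).fderiv]
    rfl
  ext i
  rw [hcoord]
  fin_cases i
  · have : fderiv ℝ (fun x => revolutionSurface m x 0) x = _ := h12.fderiv
    simp only [Fin.zero_eta, this]
    simp
    ring
  · have : fderiv ℝ (fun x => revolutionSurface m x 1) x = _ := h13.fderiv
    simp only [Fin.mk_one, this]
    simp
    ring
  · have : fderiv ℝ (fun x => revolutionSurface m x 2) x = _ := fderiv_fst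
    simp only [Fin.reduceFinMk, this]
    simp

theorem inducedNorm_revolutionSurface {x : ℝ × ℝ} (hm : DifferentiableAt ℝ m x.1)
    (y : ℝ × ℝ) : inducedNorm (revolutionSurface m) x y =
      rotNorm (fun u => 1 + deriv m u ^ 2) (fun u => m u ^ 2) x y := by
  unfold inducedNorm rotNorm
  rw [fderiv_revolutionSurface hm, EuclideanSpace.norm_eq]
  congr 1
  simp only [Fin.sum_univ_three, Real.norm_eq_abs, sq_abs]
  simp
  linear_combination (deriv m x.1 ^ 2 * y.1 ^ 2 + m x.1 ^ 2 * y.2 ^ 2) *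
    Real.sin_sq_add_cos_sq x.2

theorem slopeMetric_revolutionSurface {x : ℝ × ℝ} (hm : DifferentiableAt ℝ m x.1)
    (y : ℝ × ℝ) : slopeMetric (revolutionSurface m) x y =
      rotSlope (fun u => 1 + deriv m u ^ 2) (fun u => m u ^ 2) x y := by
  unfold slopeMetric rotSlope altitudeForm
  rw [inducedNorm_revolutionSurface hm, fderiv_revolutionSurface hm]
  simp

end Revolution

theorem mainTheorem11 (I : Set ℝ) (hI : IsOpen I) (hne : I.Nonempty) (m : ℝ → ℝ)
    (hm : ContDiffOn ℝ ∞ m I) (hpos : ∀ u ∈ I, 0 < m u) (hderiv : ∀ u ∈ I, deriv m u ≠ 0) :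
    ¬ ProjectivelyEquivalent (slopeMetric (revolutionSurface m))
        (inducedNorm (revolutionSurface m)) (I ×ˢ Set.univ) ∧
    ¬ ProjectivelyFlat (slopeMetric (revolutionSurface m)) (I ×ˢ Set.univ) := by
  obtain ⟨u, hu⟩ := hne
  set U : Set (ℝ × ℝ) := I ×ˢ Set.univ
  have hU : IsOpen U := hI.prod isOpen_univ
  have hmem : ∀ x ∈ U, x.1 ∈ I := fun x hx => hx.1
  have hp : ((u, 0) : ℝ × ℝ) ∈ U := ⟨hu, mem_univ _⟩
  have hm' : ∀ u ∈ I, ContDiffAt ℝ ∞ m u := fun u hu => hm.contDiffAt (hI.mem_nhds hu)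
  have hmd : ∀ u ∈ I, DifferentiableAt ℝ m u := fun u hu =>
    (hm' u hu).differentiableAt (by simp)
  set e : ℝ → ℝ := fun u => 1 + deriv m u ^ 2
  set g : ℝ → ℝ := fun u => m u ^ 2
  have he : ∀ x ∈ U, 1 < e x.1 := fun x hx =>
    lt_add_of_pos_right 1 (pow_two_pos_of_ne_zero (hderiv _ (hmem x hx)))
  have hg : ∀ x ∈ U, 0 < g x.1 := fun x hx => pow_pos (hpos _ (hmem x hx)) 2
  have hdm : ContDiffOn ℝ ∞ (deriv m) I := hm.deriv_of_isOpen hI (by simp)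
  have hed : ∀ x ∈ U, ContDiffAt ℝ 2 e x.1 := fun x hx =>
    contDiffAt_const.add
      ((contDiffAt_infty.1 (hdm.contDiffAt (hI.mem_nhds (hmem x hx))) 2).pow 2)
  have hgd : ∀ x ∈ U, ContDiffAt ℝ 2 g x.1 := fun x hx =>
    (contDiffAt_infty.1 (hm' _ (hmem x hx)) 2).pow 2
  have hα : ∀ x ∈ U, ∀ y, inducedNorm (revolutionSurface m) x y = rotNorm e g x y :=
    fun x hx y => inducedNorm_revolutionSurface (hmd _ (hmem x hx)) y
  have hF : ∀ x ∈ U, ∀ y, slopeMetric (revolutionSurface m) x y = rotSlope e g x y :=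
    fun x hx y => slopeMetric_revolutionSurface (hmd _ (hmem x hx)) y
  -- At the point `(u, 0)` some direction admits no geodesic of `F` whose reverse is a geodesic.
  have key : ¬ ∀ y : ℝ × ℝ, y ≠ 0 →
      ∃ (c : ℝ → ℝ × ℝ) (J : Set ℝ), IsOpen J ∧ (0 : ℝ) ∈ J ∧ c 0 = (u, 0) ∧ deriv c 0 = y ∧
        IsUnparamGeodesic (slopeMetric (revolutionSurface m)) U c J ∧
        IsUnparamGeodesic (slopeMetric (revolutionSurface m)) U (fun t => c (-t)) J := by
    intro hall
    have hdir : ∀ b : ℝ, b ≠ 0 → deriv e u = deriv g u * b ^ 2 := fun b hb => by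
      obtain ⟨c, J, hJ, h0, hc0, hc1, h1, h2⟩ :=
        hall (1, b) fun h => one_ne_zero (congrArg Prod.fst h)
      have := eq_of_reversible_geodesic he hg
        (fun x hx => (hed x hx).differentiableAt (by norm_num))
        (fun x hx => (hgd x hx).differentiableAt (by norm_num)) hJ h0 (hc0 ▸ hp)
        (h1.congr hU hF) (h2.congr hU hF) (by rw [hc1]; exact one_ne_zero) (by rw [hc1]; exact hb)
      simpa [hc0, hc1] using this
    -- The directions `(1, 1)` and `(1, 2)` give `e' = g'` and `e' = 4 g'`.
    have hg0 : deriv g u = 0 := by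
      linarith [hdir 1 one_ne_zero, hdir 2 two_ne_zero]
    have hg1 : deriv g u = 2 * m u * deriv m u := by
      simpa using ((hmd u hu).hasDerivAt.fun_pow 2).deriv
    exact mul_ne_zero (mul_ne_zero two_ne_zero (hpos u hu).ne') (hderiv u hu)
      (hg1.symm.trans hg0)
  refine ⟨fun h => key fun y hy => ?_, fun h => key fun y hy => h.exists_reversible_geodesic hp hy⟩
  obtain ⟨c, J, hJ, h0, hc0, hc1, h1, h2⟩ := exists_reversible_geodesic hU he hg hed hgd hp hy
  have hα' : ∀ x ∈ U, ∀ y, rotNorm e g x y = inducedNorm (revolutionSurface m) x y :=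
    fun x hx y => (hα x hx y).symm
  exact ⟨c, J, hJ, h0, hc0, hc1, (h c J).2 (h1.isUnparamGeodesic.congr hU hα'),
    (h _ J).2 (h2.isUnparamGeodesic.congr hU hα')⟩
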